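/- Work over the constant $C_2$-Mackey ring $\underline{\mathbb{Z}/2}$ (value $\mathbb{Z}/2$ at both orbits, $t=p^*=\mathrm{id}$, $p_*=2=0$). A module $M$ over it has values $M_\Theta$ (free orbit) and $M_\bullet$ (trivial orbit) and structure maps $t\colon M_\Theta\to M_\Theta$, $p^*\colon M_\bullet\to M_\Theta$, $p_*\colon M_\Theta\to M_\bullet$. Let $H=\underline{\mathbb{Z}/2}$ as a module over itself, with $1\in H_\bullet$, and let $F$ be the free module on one generator $g\in F_\Theta$. Write $1+t\colon F\to F$ for the map with $g\mapsto g+tg$, and $p$ for the nonzero maps $F\to H$, $g\mapsto p^*(1)$, and $H\to F$, $1\mapsto p_*(g)$. Complexes are $\mathbb{Z}$-graded, with differentials lowering the degree by one. Define the following complexes, in which all differentials $F\to F$ are $1+t$, all differentials $F\to H$ and $H\to F$ are $p$, and the terms not mentioned are $0$: - $A_k$ ($k\ge 0$): $F$ in degrees $0,\dots,k$. - $B_r$ ($r\ge 0$): $H$ in degrees $0$ and $-(r+2)$, and $F$ in degrees $-1,\dots,-(r+1)$. - $H(n)$ ($n\in\mathbb{Z}$): $H$ in degree $-n$; moreover,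 if $n>0$, $F$ in degrees $0,-1,\dots,-(n-1)$, and if $n<0$, $F$ in degrees $0,1,\dots,-n-1$. For a module $M$ let $\mathbb{D}(M)$ be the complex with $M$ in degrees $1$ and $0$, the identity as differential between them, and $0$ elsewhere. **Theorem.** Let $C$ be a bounded chain complex of $\underline{\mathbb{Z}/2}$-modules that in each degree is (isomorphic to) a finite direct sum of copies of $F$ and $H$. Then $C$ is isomorphic, as a chain complex, to a finite direct sum of shifts of complexes of the forms $A_k$ ($k\ge0$), $B_r$ ($r\ge0$), $H(n)$ ($n\in\mathbb{Z}$), $\mathbb{D}(F)$ and $\mathbb{D}(H)$. -/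

import Mathlib

open CategoryTheory CategoryTheory.Limits

/-- A Mackey functor for the cyclic group `C₂`, as a diagram of abelian groups: `Θ` is the value on
the free orbit, `pt` the value on the trivial orbit, `t` the involution, `res` the restriction
`p^*` and `tr` the transfer `p_*`. -/
structure MackeyFunctor where
  Θ : Type
  pt : Type
  [grpΘ : AddCommGroup Θ]
  [grpPt : AddCommGroup pt]
  t : Θ →+ Θ
  res : pt →+ Θ
  tr : Θ →+ pt
  t_res : ∀ m : pt, t (res m) = res m
  tr_t : ∀ m : Θ, tr (t m) = tr m
  t_t : ∀ m : Θ, t (t m) = m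
  res_tr : ∀ m : Θ, res (tr m) = m + t m

attribute [instance] MackeyFunctor.grpΘ MackeyFunctor.grpPt

/-- A Mackey ring (for `C₂`): a Mackey functor with ring structures on both values such that `p^*`
and `t` are ring maps and `p_*` satisfies both projection formulas. -/
structure MackeyRing where
  Θ : Type
  pt : Type
  [ringΘ : Ring Θ]
  [ringPt : Ring pt]
  t : Θ →+* Θ
  res : pt →+* Θ
  tr : Θ →+ pt
  t_res : ∀ m : pt, t (res m) = res m
  tr_t : ∀ m : Θ, tr (t m) = tr m
  t_t : ∀ m : Θ, t (t m) = m
  res_tr : ∀ m : Θ, res (tr m) = m + t m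
  tr_res_mul : ∀ (x : pt) (m : Θ), tr (res x * m) = x * tr m
  tr_mul_res : ∀ (m : Θ) (x : pt), tr (m * res x) = tr m * x

attribute [instance] MackeyRing.ringΘ MackeyRing.ringPt

/-- The constant Mackey ring with value `A`: both values are `A`, `p^* = t = id`, and `p_*` is
multiplication by `2`. -/
abbrev MackeyRing.const (A : Type) [Ring A] : MackeyRing where
  Θ := A
  pt := A
  t := RingHom.id A
  res := RingHom.id A
  tr := 2 • AddMonoidHom.id A
  t_res _ := rfl
  tr_t _ := rfl
  t_t _ := rfl
  res_tr m := by simp [two_nsmul]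
  tr_res_mul x m := by simp [two_mul, mul_add]
  tr_mul_res m x := by simp [two_mul, add_mul]

/-- A (left) module over a Mackey ring `R`. -/
structure MackeyModule (R : MackeyRing) extends MackeyFunctor where
  [modΘ : Module R.Θ Θ]
  [modPt : Module R.pt pt]
  res_smul : ∀ (x : R.pt) (m : pt), res (x • m) = R.res x • res m
  t_smul : ∀ (x : R.Θ) (m : Θ), t (x • m) = R.t x • t m
  tr_res_smul : ∀ (x : R.pt) (m : Θ), tr (R.res x • m) = x • tr m
  tr_smul_res : ∀ (x : R.Θ) (m : pt), tr (x • res m) = R.tr x • m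

attribute [instance] MackeyModule.modΘ MackeyModule.modPt

namespace MackeyModule

variable {R : MackeyRing}

/-- An `R`-linear map of Mackey functors. -/
@[ext]
structure Hom (M N : MackeyModule R) where
  mapΘ : M.Θ →ₗ[R.Θ] N.Θ
  mapPt : M.pt →ₗ[R.pt] N.pt
  map_t : ∀ m : M.Θ, mapΘ (M.t m) = N.t (mapΘ m)
  map_res : ∀ m : M.pt, mapΘ (M.res m) = N.res (mapPt m)
  map_tr : ∀ m : M.Θ, mapPt (M.tr m) = N.tr (mapΘ m)

instance : Category (MackeyModule R) where
  Hom M N := Hom M N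
  id M :=
    { mapΘ := LinearMap.id
      mapPt := LinearMap.id
      map_t := fun _ => rfl
      map_res := fun _ => rfl
      map_tr := fun _ => rfl }
  comp f g :=
    { mapΘ := g.mapΘ.comp f.mapΘ
      mapPt := g.mapPt.comp f.mapPt
      map_t := fun m => by simp [f.map_t, g.map_t]
      map_res := fun m => by simp [f.map_res, g.map_res]
      map_tr := fun m => by simp [f.map_tr, g.map_tr] }

@[ext]
theorem hom_ext {M N : MackeyModule R} {f g : M ⟶ N} (h₁ : f.mapΘ = g.mapΘ)
    (h₂ : f.mapPt = g.mapPt) : f = g :=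
  Hom.ext h₁ h₂

@[simp] theorem id_mapΘ (M : MackeyModule R) : Hom.mapΘ (𝟙 M) = LinearMap.id := rfl
@[simp] theorem id_mapPt (M : MackeyModule R) : Hom.mapPt (𝟙 M) = LinearMap.id := rfl
@[simp] theorem comp_mapΘ {M N P : MackeyModule R} (f : M ⟶ N) (g : N ⟶ P) :
    Hom.mapΘ (f ≫ g) = g.mapΘ.comp f.mapΘ := rfl
@[simp] theorem comp_mapPt {M N P : MackeyModule R} (f : M ⟶ N) (g : N ⟶ P) :
    Hom.mapPt (f ≫ g) = g.mapPt.comp f.mapPt := rfl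

section Preadditive

variable {M N : MackeyModule R}

instance : Zero (M ⟶ N) :=
  ⟨{ mapΘ := 0, mapPt := 0, map_t := by simp, map_res := by simp, map_tr := by simp }⟩

instance : Add (M ⟶ N) :=
  ⟨fun f g =>
    { mapΘ := f.mapΘ + g.mapΘ
      mapPt := f.mapPt + g.mapPt
      map_t := by simp [f.map_t, g.map_t]
      map_res := by simp [f.map_res, g.map_res]
      map_tr := by simp [f.map_tr, g.map_tr] }⟩

instance : Neg (M ⟶ N) :=
  ⟨fun f =>
    { mapΘ := -f.mapΘ
      mapPt := -f.mapPt
      map_t := by simp [f.map_t]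
      map_res := by simp [f.map_res]
      map_tr := by simp [f.map_tr] }⟩

@[simp] theorem zero_mapΘ : Hom.mapΘ (0 : M ⟶ N) = 0 := rfl
@[simp] theorem zero_mapPt : Hom.mapPt (0 : M ⟶ N) = 0 := rfl
@[simp] theorem add_mapΘ (f g : M ⟶ N) : Hom.mapΘ (f + g) = f.mapΘ + g.mapΘ := rfl
@[simp] theorem add_mapPt (f g : M ⟶ N) : Hom.mapPt (f + g) = f.mapPt + g.mapPt := rfl
@[simp] theorem neg_mapΘ (f : M ⟶ N) : Hom.mapΘ (-f) = -f.mapΘ := rfl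
@[simp] theorem neg_mapPt (f : M ⟶ N) : Hom.mapPt (-f) = -f.mapPt := rfl

instance : AddCommGroup (M ⟶ N) where
  add_assoc f g h := by ext x <;> simp [add_assoc]
  zero_add f := by ext x <;> simp
  add_zero f := by ext x <;> simp
  neg_add_cancel f := by ext x <;> simp
  add_comm f g := by ext x <;> simp [add_comm]
  nsmul := nsmulRec
  zsmul := zsmulRec

end Preadditive

instance : Preadditive (MackeyModule R) where
  add_comp M N P f g h := by ext x <;> simp
  comp_add M N P f g h := by ext x <;> simp

/-- The direct sum of finitely many modules, computed on each value. -/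
abbrev pi {n : ℕ} (M : Fin n → MackeyModule R) : MackeyModule R where
  Θ := ∀ j, (M j).Θ
  pt := ∀ j, (M j).pt
  t := AddMonoidHom.mk' (fun m j => (M j).t (m j)) (fun a b => by ext; simp)
  res := AddMonoidHom.mk' (fun m j => (M j).res (m j)) (fun a b => by ext; simp)
  tr := AddMonoidHom.mk' (fun m j => (M j).tr (m j)) (fun a b => by ext; simp)
  t_res m := by ext j; exact (M j).t_res _
  tr_t m := by ext j; exact (M j).tr_t _
  t_t m := by ext j; exact (M j).t_t _
  res_tr m := by ext j; exact (M j).res_tr _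
  res_smul x m := by ext j; exact (M j).res_smul _ _
  t_smul x m := by ext j; exact (M j).t_smul _ _
  tr_res_smul x m := by ext j; exact (M j).tr_res_smul _ _
  tr_smul_res x m := by ext j; exact (M j).tr_smul_res _ _

/-- The projections and inclusions of the direct sum. -/
abbrev piBicone {n : ℕ} (M : Fin n → MackeyModule R) : Bicone M where
  pt := pi M
  π j :=
    { mapΘ := LinearMap.proj j
      mapPt := LinearMap.proj j
      map_t := fun _ => rfl
      map_res := fun _ => rfl
      map_tr := fun _ => rfl }
  ι j :=
    { mapΘ := LinearMap.single R.Θ (fun i => (M i).Θ) j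
      mapPt := LinearMap.single R.pt (fun i => (M i).pt) j
      map_t := fun m => by
        ext i; exact (Pi.apply_single (fun i => (M i).t) (fun i => map_zero _) j m i).symm
      map_res := fun m => by
        ext i; exact (Pi.apply_single (fun i => (M i).res) (fun i => map_zero _) j m i).symm
      map_tr := fun m => by
        ext i; exact (Pi.apply_single (fun i => (M i).tr) (fun i => map_zero _) j m i).symm }
  ι_π i j := by
    split_ifs with h
    · subst h
      ext x <;> simp
    · ext x <;> simp [Ne.symm h]

/-- Evaluation of morphisms on the `Θ`-value, as an additive map. -/
def homΘ (M N : MackeyModule R) : (M ⟶ N) →+ (M.Θ →ₗ[R.Θ] N.Θ) where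
  toFun f := f.mapΘ
  map_zero' := rfl
  map_add' _ _ := rfl

/-- Evaluation of morphisms on the `pt`-value, as an additive map. -/
def homPt (M N : MackeyModule R) : (M ⟶ N) →+ (M.pt →ₗ[R.pt] N.pt) where
  toFun f := f.mapPt
  map_zero' := rfl
  map_add' _ _ := rfl

theorem piBicone_total {n : ℕ} (M : Fin n → MackeyModule R) :
    ∑ j, (piBicone M).π j ≫ (piBicone M).ι j = 𝟙 (piBicone M).pt := by
  apply hom_ext
  · change homΘ _ _ (∑ j, _) = _
    rw [map_sum]
    refine LinearMap.ext fun x => ?_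
    rw [LinearMap.sum_apply]
    exact Finset.univ_sum_single (M := fun i => (M i).Θ) x
  · change homPt _ _ (∑ j, _) = _
    rw [map_sum]
    refine LinearMap.ext fun x => ?_
    rw [LinearMap.sum_apply]
    exact Finset.univ_sum_single (M := fun i => (M i).pt) x

instance : HasFiniteBiproducts (MackeyModule R) :=
  ⟨fun _ => ⟨fun M => ⟨⟨⟨piBicone M, isBilimitOfTotal _ (piBicone_total M)⟩⟩⟩⟩⟩

instance : HasBinaryBiproducts (MackeyModule R) := hasBinaryBiproducts_of_finite_biproducts _

/-- The zero module. -/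
abbrev zeroModule (R : MackeyRing) : MackeyModule R where
  Θ := PUnit
  pt := PUnit
  t := 0
  res := 0
  tr := 0
  t_res _ := rfl
  tr_t _ := rfl
  t_t _ := rfl
  res_tr _ := rfl
  res_smul _ _ := rfl
  t_smul _ _ := rfl
  tr_res_smul _ _ := rfl
  tr_smul_res _ _ := rfl

theorem isZero_zeroModule (R : MackeyRing) : IsZero (zeroModule R) := by
  rw [IsZero.iff_id_eq_zero]
  rfl

instance : HasZeroObject (MackeyModule R) := ⟨⟨_, isZero_zeroModule R⟩⟩

end MackeyModule

instance MackeyModule.hasFiniteBiproducts_chainComplex (R : MackeyRing) :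
    HasFiniteBiproducts (ChainComplex (MackeyModule R) ℤ) :=
  haveI : HasFiniteProducts (ChainComplex (MackeyModule R) ℤ) := ⟨fun _ => inferInstance⟩
  HasFiniteBiproducts.of_hasFiniteProducts

namespace C2

/-- The category of modules over the constant Mackey ring with value `ℤ/2`. -/
abbrev Mod : Type 1 := MackeyModule (MackeyRing.const (ZMod 2))

instance (M : Mod) : Module (ZMod 2) M.Θ := M.modΘ

instance (M : Mod) : Module (ZMod 2) M.pt := M.modPt

/-- `H`: the constant Mackey ring as a module over itself. -/
abbrev H : Mod where
  Θ := ZMod 2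
  pt := ZMod 2
  t := AddMonoidHom.id _
  res := AddMonoidHom.id _
  tr := 2 • AddMonoidHom.id _
  t_res _ := rfl
  tr_t _ := rfl
  t_t _ := rfl
  res_tr := by decide
  res_smul _ _ := rfl
  t_smul _ _ := rfl
  tr_res_smul := by decide
  tr_smul_res := by decide

/-- `F`: the free module on a generator `g` of the `Θ`-value. The pair `(a, b)` is `a g + b t(g)`,
and `a : F.pt` is `a p_*(g)`. -/
abbrev F : Mod where
  Θ := ZMod 2 × ZMod 2
  pt := ZMod 2
  t := (AddMonoidHom.snd _ _).prod (AddMonoidHom.fst _ _)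
  res := (AddMonoidHom.id _).prod (AddMonoidHom.id _)
  tr := AddMonoidHom.fst _ _ + AddMonoidHom.snd _ _
  t_res _ := rfl
  tr_t := by decide
  t_t _ := rfl
  res_tr := by decide
  res_smul _ _ := rfl
  t_smul _ _ := rfl
  tr_res_smul := by decide
  tr_smul_res := by decide

/-- `t : F ⟶ F`, the map that sends `g` to `t(g)`. -/
abbrev tF : F ⟶ F where
  mapΘ := (LinearMap.snd _ _ _).prod (LinearMap.fst _ _ _)
  mapPt := LinearMap.id
  map_t _ := rfl
  map_res _ := rfl
  map_tr := by decide

/-- `p : F ⟶ H`, the nonzero map: it sends `g` to `p^*(1)`. -/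
abbrev pFH : F ⟶ H where
  mapΘ := LinearMap.fst _ _ _ + LinearMap.snd _ _ _
  mapPt := 0
  map_t := by decide
  map_res := by decide
  map_tr := by decide

/-- `p : H ⟶ F`, the nonzero map: it sends `1` to `p_*(g)`. -/
abbrev pHF : H ⟶ F where
  mapΘ := LinearMap.id.prod LinearMap.id
  mapPt := LinearMap.id
  map_t _ := rfl
  map_res _ := rfl
  map_tr := by decide

/-- The possible terms of a strand. -/
inductive Cell
  | zero
  | F
  | H

/-- The module in a given spot of a strand. -/
abbrev Cell.obj : Cell → Mod
  | .zero => MackeyModule.zeroModule _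
  | .F => C2.F
  | .H => C2.H

/-- The differential between two adjacent spots of a strand: `1 + t` from `F` to `F`, and `p` between
`F` and `H`. -/
def Cell.map : (a b : Cell) → (a.obj ⟶ b.obj)
  | .F, .F => 𝟙 C2.F + tF
  | .F, .H => pFH
  | .H, .F => pHF
  | _, _ => 0

theorem Cell.map_comp_map (a b c : Cell) (h : ¬ (a = .F ∧ b = .H ∧ c = .F)) :
    a.map b ≫ b.map c = 0 := by
  have key : ∀ {M N : Mod} (f : M ⟶ N), (∀ x, f.mapΘ x = 0) → (∀ x, f.mapPt x = 0) → f = 0 :=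
    fun f h₁ h₂ => MackeyModule.hom_ext (LinearMap.ext h₁) (LinearMap.ext h₂)
  cases a <;> cases b <;> cases c <;>
    first
    | exact absurd ⟨rfl, rfl, rfl⟩ h
    | exact zero_comp
    | exact comp_zero
    | exact key _ (by decide) (by decide)

/-- The chain complex with the module `c i` in degree `i`, and the standard differentials. -/
abbrev strand (c : ℤ → Cell)
    (hc : ∀ i, ¬ (c (i + 2) = .F ∧ c (i + 1) = .H ∧ c i = .F)) : ChainComplex Mod ℤ where
  X i := (c i).obj
  d i j := if j + 1 = i then (c i).map (c j) else 0
  shape i j hij := if_neg hij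
  d_comp_d' i j k hij hjk := by
    obtain rfl : j + 1 = i := hij
    obtain rfl : k + 1 = j := hjk
    rw [if_pos rfl, if_pos rfl]
    refine Cell.map_comp_map _ _ _ ?_
    have := hc k
    rwa [show k + 2 = k + 1 + 1 by ring] at this

/-- `A_k`: copies of `F` in degrees `0, …, k`. -/
def A (k : ℕ) : ChainComplex Mod ℤ :=
  strand (fun i => if 0 ≤ i ∧ i ≤ k then .F else .zero) (by intro i; grind)

/-- `B_r`: copies of `H` in degrees `0` and `-(r+2)`, and copies of `F` strictly in between. -/
def B (r : ℕ) : ChainComplex Mod ℤ :=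
  strand (fun i =>
    if i = 0 ∨ i = -(r + 2) then .H
    else if -(r + 2) < i ∧ i < 0 then .F
    else .zero) (by intro i; grind)

/-- `H(n)`: one copy of `H`, in degree `-n`, and a copy of `F` in each degree from `0` up to (and
excluding) `-n` if `n < 0`, and in each degree from `0` down to (and excluding) `-n` if `0 < n`. -/
def HH (n : ℤ) : ChainComplex Mod ℤ :=
  strand (fun i =>
    if i = -n then .H
    else if (0 ≤ i ∧ i < -n) ∨ (-n < i ∧ i ≤ 0) then .F
    else .zero) (by intro i; grind)

/-- The disk `𝔻(M)`: the module `M` in degrees `1` and `0`, with the identity as differential. -/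
noncomputable def disk (M : Mod) : ChainComplex Mod ℤ :=
  HomologicalComplex.double (𝟙 M) (show (ComplexShape.down ℤ).Rel 1 0 from rfl)

/-- The shift of a complex by `s`: its term in degree `i` is the term of `C` in degree `i - s`. The
customary sign `(-1)^s` of the differential equals `1` here, since `2 = 0` on every module. -/
abbrev shift (s : ℤ) (C : ChainComplex Mod ℤ) : ChainComplex Mod ℤ where
  X i := C.X (i - s)
  d i j := C.d (i - s) (j - s)
  shape i j hij := C.shape _ _ fun h => hij (by
    have h' : (j - s) + 1 = i - s := h
    change j + 1 = i
    linarith)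
  d_comp_d' i j k _ _ := C.d_comp_d _ _ _

/-- The types of summands. -/
inductive Summand
  | A (k : ℕ)
  | B (r : ℕ)
  | H (n : ℤ)
  | diskF
  | diskH

/-- The unshifted complex of a given type. -/
noncomputable def Summand.complex : Summand → ChainComplex Mod ℤ
  | .A k => C2.A k
  | .B r => C2.B r
  | .H n => C2.HH n
  | .diskF => disk C2.F
  | .diskH => disk C2.H

/-- The module is isomorphic to a finite direct sum of copies of `F` and `H`. -/
def IsFiniteFree (M : Mod) : Prop :=
  ∃ m n : ℕ, Nonempty (M ≅ (⨁ fun _ : Fin m => F) ⊞ (⨁ fun _ : Fin n => H))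

/-- The complex vanishes outside a finite range of degrees. -/
def IsBounded (C : ChainComplex Mod ℤ) : Prop :=
  ∃ a b : ℤ, ∀ i, (i < a ∨ b < i) → IsZero (C.X i)

end C2

/-!
# Complexes of finite free modules over the constant `C₂`-Mackey ring `ℤ/2`

A finite direct sum of copies of `F` and `H` is the fixed point functor of a finite-dimensional
representation `V = M_Θ` of `C₂` over `ℤ/2` (`IsFiniteFree.isFixedPointFunctor`). This property passes
to retracts, and it makes maps computable on `V` alone: with `ν = 1 + t`, maps `F ⟶ M` are
vectors of `V`, maps `H ⟶ M` are vectors killed by `ν`, maps `M ⟶ F` are functionals on `V`, and maps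
`M ⟶ H` are functionals that kill the image of `ν`. The endomorphism of `F` made of a vector `x` and a
functional `ψ` is invertible if and only if `ψ (ν x) = 1`.

It is therefore enough to split one summand off each nonzero complex (`exists_retract`), because
the complement, a kernel, is again a complex of fixed point functors, of smaller total dimension
(`exists_decomposition`). If a differential has a component `F ⟶ F` or `H ⟶ H` that is invertible, then
a disk splits off. Otherwise, if `ν = 0` everywhere, the differential vanishes and a copy of `H`
splits off.

In the remaining case, a map from a strand to the complex `C` is a chain of vectors `x i` with
`d (x i) = ν (x (i - 1))`, and a map from `C` to the strand is a chain of functionals with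
`ψ (i - 1) ∘ d = ψ i ∘ ν`; so both live on the sequence of linear relations `d x = ν y`. In the highest
degree `a` with `ν ≠ 0`, let `W` be the image of `d` if this is nonzero, and the image of `ν`
otherwise. The image of `ν` is filtered by how long a vector can be continued to a chain that ends
in zero, or to a chain at all. A vector of `W` in the smallest term of the filtration that meets
`W`, with a functional that kills the preceding term, can be continued to a chain and a dual chain
which stop in the same degree (`exists_maximal_chain`). At each of its two ends, the chain either
stops at zero or is attached to a copy of `H`, and the four combinations are the strands `A`, `B` and
`H(n)` for `n > 0` and `n < 0` (`exists_retract_of_norm_ne_zero`).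
-/

namespace C2

/-! ### Chains along a sequence of linear relations -/

section Relations

variable {K : Type*} [Field K] {V : ℤ → Type*} [∀ i, AddCommGroup (V i)] [∀ i, Module K (V i)]
  (f : ∀ i, V i →ₗ[K] V i) (d : ∀ i j, V i →ₗ[K] V j)

/-- The vectors `x` of `V i` for which `d x = f y` with `y ∈ S (i - 1)`: the preimage of `S` under
the linear relation `d x = f y`. -/
def pull (S : ∀ i, Submodule K (V i)) (i : ℤ) : Submodule K (V i) :=
  ((S (i - 1)).map (f (i - 1))).comap (d i (i - 1))

/-- The `m`-fold preimage of `S`: the starting vectors of chains of length `m` that end in `S`. -/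
def pullIter (S : ∀ i, Submodule K (V i)) : ℕ → ∀ i, Submodule K (V i)
  | 0 => S
  | m + 1 => pull f d (pullIter S m)

theorem pullIter_pull (S : ∀ i, Submodule K (V i)) (m : ℕ) :
    pullIter f d (pull f d S) m = pullIter f d S (m + 1) := by
  induction m with
  | zero => rfl
  | succ m ih => exact congrArg (pull f d) ih

theorem pullIter_congr {S S' : ∀ i, Submodule K (V i)} (m : ℕ) (a : ℤ)
    (h : S (a - m) = S' (a - m)) : pullIter f d S m a = pullIter f d S' m a := by
  induction m generalizing a with
  | zero =>
    rw [show a - ((0 : ℕ) : ℤ) = a by simp] at h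
    exact h
  | succ m ih =>
    have := ih (a - 1) (by
      rw [show a - 1 - (m : ℤ) = a - (m + 1 : ℕ) by push_cast; ring]; exact h)
    simp only [pullIter, pull, this]

variable {f d}

/-- A functional that kills the image under `g` of the preimage of `Z` under `h` can be carried
along the relation `{(g w, h w)}` to a functional that kills `Z`. -/
theorem exists_dual_transport {U U' W : Type*} [AddCommGroup U] [Module K U] [AddCommGroup U']
    [Module K U'] [AddCommGroup W] [Module K W] (g : W →ₗ[K] U) (h : W →ₗ[K] U')
    (Z : Submodule K U') (φ : Module.Dual K U) (hφ : ∀ w, h w ∈ Z → φ (g w) = 0) :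
    ∃ φ' : Module.Dual K U', (∀ z ∈ Z, φ' z = 0) ∧ ∀ w, φ' (h w) = φ (g w) := by
  have hmem : φ.comp g ∈ LinearMap.range (Z.mkQ.comp h).dualMap := by
    rw [LinearMap.range_dualMap_eq_dualAnnihilator_ker, Submodule.mem_dualAnnihilator]
    intro w hw
    exact hφ w (by simpa using hw)
  obtain ⟨χ, hχ⟩ := hmem
  refine ⟨χ.comp Z.mkQ, fun z hz => ?_, fun w => LinearMap.congr_fun hχ w⟩
  simp [(Submodule.Quotient.mk_eq_zero Z).2 hz]

/-- A vector of the `m`-fold preimage of `S` starts a chain of length `m` ending in `S`, and a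
functional that kills the image under `f` of the `m`-fold preimage of `S'` starts a dual chain whose
end kills the image of `S'`. -/
theorem exists_chain {S S' : ∀ i, Submodule K (V i)} (m : ℕ) (a : ℤ) (x₀ : V a)
    (hx₀ : x₀ ∈ pullIter f d S m a) (ψ₀ : Module.Dual K (V a))
    (hψ₀ : ∀ u ∈ pullIter f d S' m a, ψ₀ (f a u) = 0) :
    ∃ (x : ∀ i, V i) (ψ : ∀ i, Module.Dual K (V i)), x a = x₀ ∧ ψ a = ψ₀ ∧ x (a - m) ∈ S (a - m) ∧
      (∀ u ∈ S' (a - m), ψ (a - m) (f (a - m) u) = 0) ∧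
      (∀ i, a - m ≤ i → i ≤ a → ψ i (f i (x i)) = ψ₀ (f a x₀)) ∧
      ∀ i, a - m < i → i ≤ a → d i (i - 1) (x i) = f (i - 1) (x (i - 1)) ∧
        ∀ u, ψ (i - 1) (d i (i - 1) u) = ψ i (f i u) := by
  induction m generalizing a with
  | zero =>
    have h0 : a - ((0 : ℕ) : ℤ) = a := by simp
    refine ⟨fun i => if h : a = i then h ▸ x₀ else 0, fun i => if h : a = i then h ▸ ψ₀ else 0,
      by simp, by simp, ?_, ?_, ?_, ?_⟩
    · rw [h0]; simpa [pullIter] using hx₀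
    · rw [h0]; simpa [pullIter] using hψ₀
    · intro i h1 h2
      obtain rfl : i = a := by omega
      simp
    · intro i h1 h2
      omega
  | succ m ih =>
    obtain ⟨x₁, hx₁, hx₁'⟩ := hx₀
    obtain ⟨ψ₁, hψ₁, hψ₁'⟩ := exists_dual_transport (f a) (d a (a - 1))
      ((pullIter f d S' m (a - 1)).map (f (a - 1))) ψ₀ hψ₀
    obtain ⟨x, ψ, rfl, rfl, hS, hS', h1, hc⟩ := ih (a - 1) x₁ hx₁ ψ₁
      (fun u hu => hψ₁ _ (Submodule.mem_map_of_mem hu))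
    have he : a - 1 - (m : ℤ) = a - (m + 1 : ℕ) := by push_cast; ring
    rw [he] at hS hS' h1 hc
    have key : ψ (a - 1) (f (a - 1) (x (a - 1))) = ψ₀ (f a x₀) := by rw [hx₁', hψ₁']
    refine ⟨Function.update x a x₀, Function.update ψ a ψ₀, by simp, by simp, ?_, ?_, ?_, ?_⟩
    · rwa [Function.update_of_ne (by omega)]
    · rwa [Function.update_of_ne (by omega)]
    · intro i h2 h3
      rcases eq_or_ne i a with rfl | hi
      · simp
      · rw [Function.update_of_ne hi, Function.update_of_ne hi, h1 i h2 (by omega), key]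
    · intro i h2 h3
      rw [Function.update_of_ne (show i - 1 ≠ a by omega),
        Function.update_of_ne (show i - 1 ≠ a by omega)]
      rcases eq_or_ne i a with rfl | hi
      · simp only [Function.update_self]
        exact ⟨hx₁'.symm, hψ₁'⟩
      · rw [Function.update_of_ne hi, Function.update_of_ne hi]
        exact hc i h2 (by omega)

/-- If `W` meets the image of `P` under `g` but not that of `N`, then some vector in `W` and in the
image of `P` is separated from the image of `N` by a functional. -/
theorem exists_vector_dual {U : Type*} [AddCommGroup U] [Module K U] (g : U →ₗ[K] U)
    (W P N : Submodule K U) (hP : W ⊓ P.map g ≠ ⊥) (hN : W ⊓ N.map g = ⊥) :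
    ∃ x ∈ P, g x ∈ W ∧ ∃ ψ : Module.Dual K U, ψ (g x) = 1 ∧ ∀ u ∈ N, ψ (g u) = 0 := by
  obtain ⟨p, ⟨hpW, x, hx, rfl⟩, hp0⟩ := Submodule.exists_mem_ne_zero_of_ne_bot hP
  have hpN : g x ∉ N.map g := fun h => hp0 (by
    have : g x ∈ W ⊓ N.map g := ⟨hpW, h⟩
    rwa [hN, Submodule.mem_bot] at this)
  obtain ⟨φ, hφ, hle⟩ := Submodule.exists_le_ker_of_notMem hpN
  refine ⟨x, hx, hpW, (φ (g x))⁻¹ • φ, by simp [hφ], fun u hu => ?_⟩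
  have : φ (g u) = 0 := hle (Submodule.mem_map_of_mem hu)
  simp [this]

/-- For each nonzero subspace `W` of the range of `f a`, there is a chain `x a, …, x e` with
`f (x a) ∈ W`, together with a dual chain `ψ a, …, ψ e` that satisfies `ψ i (f (x i)) = 1`, such
that either `d (x e) = 0`, or the dual chain can be continued by a functional that kills the range
of `f`.

The vector `f (x a)` is taken from the smallest term that meets `W` of the flag
`Z₀ ⊆ Z₁ ⊆ ⋯ ⊆ D₁ ⊆ D₀`, where `Zₖ` (or `Dₖ`) consists of the vectors `f x` for which `x` starts a
chain of length `k` that ends in `0` (or in any vector); the functional `ψ a` kills the preceding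
term. -/
theorem exists_maximal_chain (lo a : ℤ) (hlo : ∀ i < lo, Subsingleton (V i))
    (W : Submodule K (V a)) (hW : W ≠ ⊥) (hWf : W ≤ LinearMap.range (f a)) :
    ∃ (e : ℤ) (x : ∀ i, V i) (ψ : ∀ i, Module.Dual K (V i)), e ≤ a ∧ f a (x a) ∈ W ∧
      (∀ i, e ≤ i → i ≤ a → ψ i (f i (x i)) = 1) ∧
      (∀ i, e < i → i ≤ a → d i (i - 1) (x i) = f (i - 1) (x (i - 1)) ∧
        ∀ u, ψ (i - 1) (d i (i - 1) u) = ψ i (f i u)) ∧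
      (d e (e - 1) (x e) = 0 ∨ ∃ χ : Module.Dual K (V (e - 1)), (∀ v, χ (f (e - 1) v) = 0) ∧
        ∀ u, χ (d e (e - 1) u) = ψ e (f e u)) := by
  classical
  by_cases hZ : ∃ k, W ⊓ (pullIter f d (fun _ => ⊥) k a).map (f a) ≠ ⊥
  · obtain ⟨m, hm⟩ : ∃ m, Nat.find hZ = m + 1 := Nat.exists_eq_succ_of_ne_zero fun h => by
      have := Nat.find_spec hZ
      rw [h] at this
      simp [pullIter] at this
    have h1 := Nat.find_spec hZ
    have h2 := not_not.1 (Nat.find_min hZ (m := m) (by omega))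
    rw [hm, ← pullIter_pull] at h1
    obtain ⟨x₀, hx₀, hxW, ψ₀, hψ, hψ₀⟩ := exists_vector_dual (f a) W _ _ h1 h2
    obtain ⟨x, ψ, rfl, rfl, hS, -, h3, hc⟩ := exists_chain m a x₀ hx₀ ψ₀ hψ₀
    exact ⟨a - m, x, ψ, by omega, hxW, fun i hi hi' => (h3 i hi hi').trans hψ, hc,
      Or.inl (by simpa [pull] using hS)⟩
  · push Not at hZ
    -- Far enough down there is no room, so that `Dₖ = Zₖ`.
    have hD : ∃ k, W ⊓ (pullIter f d (fun _ => ⊤) k a).map (f a) = ⊥ := by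
      refine ⟨(a - lo + 1).toNat, ?_⟩
      rw [pullIter_congr (S' := fun _ => ⊥)]
      · exact hZ _
      · have := hlo (a - (a - lo + 1).toNat) (by omega)
        exact Subsingleton.elim _ _
    obtain ⟨m, hm⟩ : ∃ m, Nat.find hD = m + 1 := Nat.exists_eq_succ_of_ne_zero fun h => by
      have := Nat.find_spec hD
      rw [h] at this
      simp only [pullIter, Submodule.map_top, inf_eq_left.2 hWf] at this
      exact hW this
    have h1 := Nat.find_spec hD
    have h2 := Nat.find_min hD (m := m) (by omega)
    rw [hm, ← pullIter_pull] at h1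
    obtain ⟨x₀, hx₀, hxW, ψ₀, hψ, hψ₀⟩ := exists_vector_dual (f a) W _ _ h2 h1
    obtain ⟨x, ψ, rfl, rfl, -, hS', h3, hc⟩ := exists_chain m a x₀ hx₀ ψ₀ hψ₀
    obtain ⟨χ, hχ, hχ'⟩ := exists_dual_transport (f (a - m)) (d (a - m) (a - m - 1))
      (LinearMap.range (f (a - m - 1))) (ψ (a - m)) (fun u hu => hS' u (by simpa [pull] using hu))
    exact ⟨a - m, x, ψ, by omega, hxW, fun i hi hi' => (h3 i hi hi').trans hψ, hc,
      Or.inr ⟨χ, fun v => hχ _ ⟨v, rfl⟩, hχ'⟩⟩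

end Relations

end C2

namespace MackeyModule

/-! ### Kernels of maps of Mackey modules -/

section Kernels

variable {R : MackeyRing} {M N : MackeyModule R} (f : M ⟶ N)

/-- The kernel of a map of Mackey modules, computed on each value. -/
abbrev kernelModule : MackeyModule R where
  Θ := LinearMap.ker f.mapΘ
  pt := LinearMap.ker f.mapPt
  t := (M.t.comp (LinearMap.ker f.mapΘ).subtype.toAddMonoidHom).codRestrict
    (LinearMap.ker f.mapΘ) fun x => by simp [f.map_t]
  res := (M.res.comp (LinearMap.ker f.mapPt).subtype.toAddMonoidHom).codRestrict
    (LinearMap.ker f.mapΘ) fun x => by simp [f.map_res]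
  tr := (M.tr.comp (LinearMap.ker f.mapΘ).subtype.toAddMonoidHom).codRestrict
    (LinearMap.ker f.mapPt) fun x => by simp [f.map_tr]
  t_res m := Subtype.ext (M.t_res _)
  tr_t m := Subtype.ext (M.tr_t _)
  t_t m := Subtype.ext (M.t_t _)
  res_tr m := Subtype.ext (M.res_tr _)
  res_smul x m := Subtype.ext (M.res_smul _ _)
  t_smul x m := Subtype.ext (M.t_smul _ _)
  tr_res_smul x m := Subtype.ext (M.tr_res_smul _ _)
  tr_smul_res x m := Subtype.ext (M.tr_smul_res _ _)

/-- The inclusion of the kernel. -/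
abbrev kernelInclusion : kernelModule f ⟶ M where
  mapΘ := (LinearMap.ker f.mapΘ).subtype
  mapPt := (LinearMap.ker f.mapPt).subtype
  map_t _ := rfl
  map_res _ := rfl
  map_tr _ := rfl

theorem kernelInclusion_comp : kernelInclusion f ≫ f = 0 := by
  ext x
  · exact x.2
  · exact x.2

/-- A map that `f` annihilates factors through the kernel. -/
abbrev kernelLift {P : MackeyModule R} (g : P ⟶ M) (h : g ≫ f = 0) : P ⟶ kernelModule f where
  mapΘ := g.mapΘ.codRestrict _ fun x => LinearMap.congr_fun (congrArg Hom.mapΘ h) x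
  mapPt := g.mapPt.codRestrict _ fun x => LinearMap.congr_fun (congrArg Hom.mapPt h) x
  map_t x := Subtype.ext (g.map_t x)
  map_res x := Subtype.ext (g.map_res x)
  map_tr x := Subtype.ext (g.map_tr x)

instance : HasKernels (MackeyModule R) where
  has_limit f := ⟨⟨⟨KernelFork.ofι (kernelInclusion f) (kernelInclusion_comp f),
    KernelFork.IsLimit.ofι _ _ (fun g h => kernelLift f g h) (fun g h => rfl) (fun g h m hm => by
      subst hm
      rfl)⟩⟩⟩

end Kernels

end MackeyModule

namespace C2

/-! ### Fixed point functors -/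

section FixedPoint

/-- The module is the fixed point functor of a finite-dimensional representation `V` of `C₂` over
`ℤ/2`: its values are `V` and the invariants of `V`, with the inclusion as `p^*`. The transfer is then
determined by `p^* p_* = 1 + t`. -/
structure IsFixedPointFunctor (M : Mod) : Prop where
  finite : Module.Finite (ZMod 2) M.Θ
  res_injective : Function.Injective M.res
  exists_res : ∀ x, M.t x = x → ∃ w, M.res w = x

variable {M N : Mod}

/-- The operator `1 + t` on the value at the free orbit. -/
def norm (M : Mod) : M.Θ →ₗ[ZMod 2] M.Θ := LinearMap.id + M.t.toZModLinearMap 2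

theorem norm_apply (x : M.Θ) : norm M x = x + M.t x := rfl

theorem res_tr_eq_norm (x : M.Θ) : M.res (M.tr x) = norm M x := M.res_tr x

theorem norm_eq_zero_iff {x : M.Θ} : norm M x = 0 ↔ M.t x = x := by
  rw [norm_apply, add_eq_zero_iff_neg_eq, ZModModule.neg_eq_self, eq_comm]

theorem norm_res (w : M.pt) : norm M (M.res w) = 0 := norm_eq_zero_iff.2 (M.t_res w)

theorem tr_res (w : M.pt) : M.tr (M.res w) = 0 := by
  have h := M.tr_smul_res (1 : ZMod 2) w
  have h2 : (MackeyRing.const (ZMod 2)).tr (1 : ZMod 2) = (0 : ZMod 2) := by decide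
  rw [h2] at h
  simpa using h

theorem map_norm (f : M ⟶ N) (x : M.Θ) : f.mapΘ (norm M x) = norm N (f.mapΘ x) := by
  rw [norm_apply, norm_apply, map_add, f.map_t]

theorem IsFixedPointFunctor.hom_ext (hN : IsFixedPointFunctor N) {f g : M ⟶ N}
    (h : ∀ x, f.mapΘ x = g.mapΘ x) : f = g := by
  refine MackeyModule.hom_ext (LinearMap.ext h) (LinearMap.ext fun w => hN.res_injective ?_)
  rw [← f.map_res, ← g.map_res, h]

theorem isFixedPointFunctor_F : IsFixedPointFunctor F where
  finite := inferInstanceAs (Module.Finite (ZMod 2) (ZMod 2 × ZMod 2))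
  res_injective := by decide
  exists_res := by decide

theorem isFixedPointFunctor_H : IsFixedPointFunctor H where
  finite := inferInstanceAs (Module.Finite (ZMod 2) (ZMod 2))
  res_injective := Function.injective_id
  exists_res x _ := ⟨x, rfl⟩

/-- A module whose identity is a finite sum of maps that factor through fixed point functors is
itself a fixed point functor. -/
theorem isFixedPointFunctor_of_sum_eq_id {ι : Type*} [Fintype ι] {P : ι → Mod}
    (hP : ∀ j, IsFixedPointFunctor (P j)) (f : ∀ j, M ⟶ P j) (g : ∀ j, P j ⟶ M)
    (hfg : ∑ j, f j ≫ g j = 𝟙 M) : IsFixedPointFunctor M := by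
  have hΘ : ∀ x, ∑ j, (g j).mapΘ ((f j).mapΘ x) = x := fun x => by
    have := congrArg (MackeyModule.homΘ M M) hfg
    rw [map_sum] at this
    have := LinearMap.congr_fun this x
    rwa [LinearMap.sum_apply] at this
  have hPt : ∀ w, ∑ j, (g j).mapPt ((f j).mapPt w) = w := fun w => by
    have := congrArg (MackeyModule.homPt M M) hfg
    rw [map_sum] at this
    have := LinearMap.congr_fun this w
    rwa [LinearMap.sum_apply] at this
  refine ⟨?_, ?_, ?_⟩
  · have := fun j => (hP j).finite
    refine Module.Finite.of_injective
      (LinearMap.pi fun j => ((f j).mapΘ : M.Θ →ₗ[ZMod 2] (P j).Θ)) fun x y hxy => ?_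
    rw [← hΘ x, ← hΘ y]
    exact Finset.sum_congr rfl fun j _ => congrArg _ (congrFun hxy j)
  · intro w w' h
    rw [← hPt w, ← hPt w']
    refine Finset.sum_congr rfl fun j _ => congrArg _ ((hP j).res_injective ?_)
    rw [← (f j).map_res, ← (f j).map_res, h]
  · intro x hx
    choose w hw using fun j => (hP j).exists_res ((f j).mapΘ x) (by rw [← (f j).map_t, hx])
    refine ⟨∑ j, (g j).mapPt (w j), ?_⟩
    rw [map_sum]
    conv_rhs => rw [← hΘ x]
    exact Finset.sum_congr rfl fun j _ => by rw [← (g j).map_res, hw]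

theorem IsFixedPointFunctor.of_retract (hN : IsFixedPointFunctor N) (f : M ⟶ N) (g : N ⟶ M)
    (h : f ≫ g = 𝟙 M) : IsFixedPointFunctor M :=
  isFixedPointFunctor_of_sum_eq_id (ι := Unit) (fun _ => hN) (fun _ => f) (fun _ => g) (by simpa)

theorem IsFiniteFree.isFixedPointFunctor (hM : IsFiniteFree M) : IsFixedPointFunctor M := by
  obtain ⟨m, n, ⟨e⟩⟩ := hM
  have hbip : ∀ (k : ℕ) (P : Mod), IsFixedPointFunctor P →
      IsFixedPointFunctor (⨁ fun _ : Fin k => P) := fun k P hP =>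
    isFixedPointFunctor_of_sum_eq_id (fun _ : Fin k => hP) (biproduct.π _) (biproduct.ι _)
      biproduct.total
  refine IsFixedPointFunctor.of_retract ?_ e.hom e.inv e.hom_inv_id
  refine isFixedPointFunctor_of_sum_eq_id (ι := Bool)
    (P := fun b => bif b then ⨁ fun _ : Fin m => F else ⨁ fun _ : Fin n => H) ?_
    (fun b => match b with | true => biprod.fst | false => biprod.snd)
    (fun b => match b with | true => biprod.inl | false => biprod.inr) ?_
  · rintro (_ | _)
    · exact hbip n _ isFixedPointFunctor_H
    · exact hbip m _ isFixedPointFunctor_F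
  · rw [Fintype.sum_bool]
    exact biprod.total

end FixedPoint

/-! ### Maps between a cell and a fixed point functor -/

section Cells

variable {M N : Mod}

theorem t_smul (a : ZMod 2) (x : M.Θ) : M.t (a • x) = a • M.t x := M.t_smul a x

theorem res_smul (a : ZMod 2) (w : M.pt) : M.res (a • w) = a • M.res w := M.res_smul a w

theorem tr_smul (a : ZMod 2) (x : M.Θ) : M.tr (a • x) = a • M.tr x := M.tr_res_smul a x

/-- The map `F ⟶ M` that sends `g` to `x`. -/
def fromF (x : M.Θ) : F ⟶ M where
  mapΘ := LinearMap.coprod (LinearMap.toSpanSingleton (ZMod 2) M.Θ x)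
    (LinearMap.toSpanSingleton (ZMod 2) M.Θ (M.t x))
  mapPt := LinearMap.toSpanSingleton (ZMod 2) M.pt (M.tr x)
  map_t m := by
    change m.2 • x + m.1 • M.t x = M.t (m.1 • x + m.2 • M.t x)
    rw [map_add, t_smul, t_smul, M.t_t, add_comm]
  map_res w := by
    change (w : ZMod 2) • x + (w : ZMod 2) • M.t x = M.res ((w : ZMod 2) • M.tr x)
    rw [res_smul, M.res_tr, smul_add]
  map_tr m := by
    change (m.1 + m.2) • M.tr x = M.tr (m.1 • x + m.2 • M.t x)
    rw [map_add, tr_smul, tr_smul, M.tr_t, add_smul]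

/-- The map `H ⟶ M` that sends `1` to `w`. -/
def fromH (w : M.pt) : H ⟶ M where
  mapΘ := LinearMap.toSpanSingleton (ZMod 2) M.Θ (M.res w)
  mapPt := LinearMap.toSpanSingleton (ZMod 2) M.pt w
  map_t m := by
    change (m : ZMod 2) • M.res w = M.t ((m : ZMod 2) • M.res w)
    rw [t_smul, M.t_res]
  map_res a := by
    change (a : ZMod 2) • M.res w = M.res ((a : ZMod 2) • w)
    rw [res_smul]
  map_tr m := by
    change (2 • (m : ZMod 2)) • w = M.tr ((m : ZMod 2) • M.res w)
    rw [tr_smul, tr_res, smul_zero, ZModModule.char_nsmul_eq_zero 2 (m : ZMod 2), zero_smul]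

/-- The map `M ⟶ F` whose coefficient at `g` is the functional `ψ`; the coefficient at `t(g)` is then
`ψ ∘ t`. -/
def toF (ψ : Module.Dual (ZMod 2) M.Θ) : M ⟶ F where
  mapΘ := ψ.prod (ψ.comp (M.t.toZModLinearMap 2))
  mapPt := ψ.comp (M.res.toZModLinearMap 2)
  map_t m := by
    change (ψ (M.t m), ψ (M.t (M.t m))) = (ψ (M.t m), ψ m)
    rw [M.t_t]
  map_res w := by
    change (ψ (M.res w), ψ (M.t (M.res w))) = (ψ (M.res w), ψ (M.res w))
    rw [M.t_res]
  map_tr m := by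
    change ψ (M.res (M.tr m)) = ψ m + ψ (M.t m)
    rw [M.res_tr, map_add]

/-- The map `M ⟶ H` given by an invariant functional. -/
def toH (ψ : Module.Dual (ZMod 2) M.Θ) (hψ : ∀ v, ψ (norm M v) = 0) : M ⟶ H where
  mapΘ := ψ
  mapPt := ψ.comp (M.res.toZModLinearMap 2)
  map_t m := by
    change ψ (M.t m) = ψ m
    have := hψ m
    rwa [norm_apply, map_add, add_eq_zero_iff_neg_eq, ZModModule.neg_eq_self, eq_comm] at this
  map_res w := rfl
  map_tr m := by
    change ψ (M.res (M.tr m)) = 2 • (ψ m : ZMod 2)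
    rw [res_tr_eq_norm, hψ, ZModModule.char_nsmul_eq_zero 2 (ψ m : ZMod 2)]

namespace Cell

/-- The generator of a cell on the free orbit (which is `p^*(1)` for `H`). -/
def gen : (c : Cell) → c.obj.Θ
  | .zero => PUnit.unit
  | .F => ((1, 0) : ZMod 2 × ZMod 2)
  | .H => (1 : ZMod 2)

/-- The coordinate of a cell on the free orbit that is dual to the generator. -/
def coord : (c : Cell) → c.obj.Θ → ZMod 2
  | .zero => fun _ => 0
  | .F => fun m => m.1
  | .H => fun m => m

/-- The elements of a fixed point functor `M` to which a map from the cell can send the generator. -/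
def IsElem (x : M.Θ) : Cell → Prop
  | .zero => x = 0
  | .F => True
  | .H => norm M x = 0

/-- The functionals on `M` that occur as the coordinate of a map to the cell. -/
def IsCoord (ψ : Module.Dual (ZMod 2) M.Θ) : Cell → Prop
  | .zero => ψ = 0
  | .F => True
  | .H => ∀ v, ψ (norm M v) = 0

/-- The image of the generator of the first cell under the standard differential followed by the
map that sends the generator of the second cell to `x`. -/
def act (x : M.Θ) : (b c : Cell) → M.Θ
  | .F, .F => norm M x
  | .F, .H => x
  | .H, .F => norm M x
  | _, _ => 0

/-- The coordinate of the map with coordinate `ψ` to the first cell, followed by the standard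
differential. -/
def coact (ψ : Module.Dual (ZMod 2) M.Θ) : (b c : Cell) → M.Θ → ZMod 2
  | .F, .F => fun u => ψ (norm M u)
  | .F, .H => fun u => ψ (norm M u)
  | .H, .F => ψ
  | _, _ => 0

theorem isFixedPointFunctor : (c : Cell) → IsFixedPointFunctor c.obj
  | .zero => ⟨inferInstanceAs (Module.Finite (ZMod 2) PUnit), fun _ _ _ => rfl, fun _ _ => ⟨0, rfl⟩⟩
  | .F => isFixedPointFunctor_F
  | .H => isFixedPointFunctor_H

theorem exists_from (hM : IsFixedPointFunctor M) (c : Cell) (x : M.Θ) (hx : c.IsElem x) :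
    ∃ φ : c.obj ⟶ M, φ.mapΘ c.gen = x := by
  cases c with
  | zero => exact ⟨0, Eq.symm hx⟩
  | F =>
    refine ⟨fromF x, ?_⟩
    change (1 : ZMod 2) • x + (0 : ZMod 2) • M.t x = x
    simp
  | H =>
    obtain ⟨w, rfl⟩ := hM.exists_res x (norm_eq_zero_iff.1 hx)
    exact ⟨fromH w, one_smul (ZMod 2) (M.res w)⟩

theorem exists_to (c : Cell) (ψ : Module.Dual (ZMod 2) M.Θ) (hψ : c.IsCoord ψ) :
    ∃ ρ : M ⟶ c.obj, ∀ u, c.coord (ρ.mapΘ u) = ψ u := by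
  cases c with
  | zero => exact ⟨0, fun u => (LinearMap.congr_fun hψ u).symm⟩
  | F => exact ⟨toF ψ, fun u => rfl⟩
  | H => exact ⟨toH ψ hψ, fun u => rfl⟩

theorem from_ext (hM : IsFixedPointFunctor M) {c : Cell} {φ φ' : c.obj ⟶ M}
    (h : φ.mapΘ c.gen = φ'.mapΘ c.gen) : φ = φ' := by
  refine hM.hom_ext fun x => ?_
  cases c with
  | zero => exact h
  | F =>
    have ht : φ.mapΘ (C2.F.t (1, 0)) = φ'.mapΘ (C2.F.t (1, 0)) := by
      rw [φ.map_t, φ'.map_t]; exact congrArg _ h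
    have hx : x = (x.1 : ZMod 2) • ((1, 0) : ZMod 2 × ZMod 2) + (x.2 : ZMod 2) • C2.F.t (1, 0) := by
      revert x; decide
    rw [hx, map_add, map_add, map_smul, map_smul, map_smul, map_smul, ht]
    exact congrArg (fun y => x.1 • y + _) h
  | H =>
    have hx : x = (x : ZMod 2) • (1 : ZMod 2) := (mul_one (x : ZMod 2)).symm
    rw [hx, map_smul, map_smul]
    exact congrArg _ h

theorem to_ext {c : Cell} {ρ ρ' : M ⟶ c.obj}
    (h : ∀ u, c.coord (ρ.mapΘ u) = c.coord (ρ'.mapΘ u)) : ρ = ρ' := by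
  refine c.isFixedPointFunctor.hom_ext fun u => ?_
  cases c with
  | zero => exact Subsingleton.elim (α := PUnit) _ _
  | F =>
    refine Prod.ext (h u) ?_
    have := h (M.t u)
    rwa [ρ.map_t, ρ'.map_t] at this
  | H => exact h u

theorem map_comp_gen (b c : Cell) (φ : c.obj ⟶ M) (x : M.Θ) (hx : φ.mapΘ c.gen = x) :
    (b.map c ≫ φ).mapΘ b.gen = act x b c := by
  subst hx
  cases b <;> cases c
  case F.F => exact map_norm φ (gen .F)
  case F.H => exact congrArg φ.mapΘ (show (1 + 0 : ZMod 2) = 1 by decide)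
  case H.F =>
    refine Eq.trans (congrArg φ.mapΘ ?_) (map_norm φ (gen .F))
    exact (show ((1, 1) : ZMod 2 × ZMod 2) = (1, 0) + (0, 1) by decide)
  all_goals exact map_zero φ.mapΘ

theorem comp_map_coord (b c : Cell) (ρ : M ⟶ b.obj) (ψ : Module.Dual (ZMod 2) M.Θ)
    (hρ : ∀ u, b.coord (ρ.mapΘ u) = ψ u) (u : M.Θ) :
    c.coord ((ρ ≫ b.map c).mapΘ u) = coact ψ b c u := by
  cases b <;> cases c
  case F.F =>
    have h2 : (ρ.mapΘ (M.t u)).1 = (ρ.mapΘ u).2 := congrArg Prod.fst (ρ.map_t u)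
    change (ρ.mapΘ u).1 + (ρ.mapΘ u).2 = ψ (u + M.t u)
    rw [map_add, ← hρ, ← hρ, ← h2]
    rfl
  case F.H =>
    have h2 : (ρ.mapΘ (M.t u)).1 = (ρ.mapΘ u).2 := congrArg Prod.fst (ρ.map_t u)
    change (ρ.mapΘ u).1 + (ρ.mapΘ u).2 = ψ (u + M.t u)
    rw [map_add, ← hρ, ← hρ, ← h2]
    rfl
  case H.F => exact hρ u
  all_goals rfl

theorem isIso_of_coord (c : Cell) (φ : c.obj ⟶ M) (ρ : M ⟶ c.obj) (x : M.Θ)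
    (ψ : Module.Dual (ZMod 2) M.Θ) (hφ : φ.mapΘ c.gen = x) (hρ : ∀ u, c.coord (ρ.mapΘ u) = ψ u)
    (hF : c = .F → ψ (norm M x) = 1) (hH : c = .H → ψ x = 1) : IsIso (φ ≫ ρ) := by
  cases c with
  | zero =>
    have : φ ≫ ρ = 𝟙 _ := (isFixedPointFunctor .zero).hom_ext fun _ => rfl
    rw [this]
    infer_instance
  | F =>
    have h1 : ((φ ≫ ρ).mapΘ (gen .F)).1 = ψ x := by rw [← hφ]; exact hρ _
    have h2 : ((φ ≫ ρ).mapΘ (gen .F)).2 = ψ (M.t x) := by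
      rw [← hρ, ← hφ, ρ.map_t]; rfl
    have h3 := hF rfl
    rw [norm_apply, map_add, ← h1, ← h2] at h3
    -- The image of `g` is `g` or `t(g)`.
    have h4 : ∀ y : ZMod 2 × ZMod 2, y.1 + y.2 = 1 → y = (1, 0) ∨ y = (0, 1) := by decide
    rcases h4 _ h3 with h | h
    · have : φ ≫ ρ = 𝟙 _ := from_ext isFixedPointFunctor_F h
      rw [this]
      infer_instance
    · have : φ ≫ ρ = tF := from_ext isFixedPointFunctor_F h
      rw [this]
      exact ⟨tF, rfl, rfl⟩
  | H =>
    have : φ ≫ ρ = 𝟙 _ := from_ext isFixedPointFunctor_H (by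
      refine Eq.trans ?_ (hH rfl)
      rw [← hφ]
      exact hρ _)
    rw [this]
    infer_instance

end Cell

end Cells

/-! ### Splitting off disks and strands -/

section Retracts

variable {C : ChainComplex Mod ℤ}

/-- A retract of a shifted complex, shifted back. -/
theorem retract_of_shift {S : ChainComplex Mod ℤ} (s : ℤ) (h : Nonempty (Retract S (shift s C))) :
    Nonempty (Retract (shift (-s) S) C) := by
  obtain ⟨⟨i, r, h⟩⟩ := h
  have e : ∀ k, k - -s - s = k := fun k => by ring
  refine ⟨⟨{ f := fun k => i.f (k - -s) ≫ (C.XIsoOfEq (e k)).hom, comm' := fun k l _ => ?_ },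
    { f := fun k => (C.XIsoOfEq (e k)).inv ≫ r.f (k - -s), comm' := fun k l _ => ?_ }, ?_⟩⟩
  · have := i.comm (k - -s) (l - -s)
    simp only [Category.assoc, HomologicalComplex.XIsoOfEq_hom_comp_d]
    rw [← Category.assoc, ← this, Category.assoc]
    exact congrArg _ (C.d_comp_XIsoOfEq_hom (e l) _).symm
  · have := r.comm (k - -s) (l - -s)
    rw [Category.assoc, this, ← Category.assoc, ← Category.assoc,
      HomologicalComplex.d_comp_XIsoOfEq_inv]
    congr 1
    exact C.XIsoOfEq_inv_comp_d (e k) _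
  · ext1 k
    have := HomologicalComplex.congr_hom h (k - -s)
    simpa using this

/-- A module that is a retract of `C₁` and of `C₀`, compatibly with the differential, gives a disk
that is a retract of `C`. -/
theorem retract_disk {M : Mod} (α : M ⟶ C.X 1) (β : C.X 0 ⟶ M) (h : α ≫ C.d 1 0 ≫ β = 𝟙 M) :
    Nonempty (Retract (disk M) C) := by
  have h10 : (1 : ℤ) ≠ 0 := by decide
  have hrel : (ComplexShape.down ℤ).Rel 1 0 := rfl
  let e₀ : (disk M).X 1 ≅ M := HomologicalComplex.doubleXIso₀ (𝟙 M) hrel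
  let e₁ : (disk M).X 0 ≅ M := HomologicalComplex.doubleXIso₁ (𝟙 M) hrel h10
  obtain ⟨f, hf1, hf0⟩ : ∃ f : ∀ k, C.X k ⟶ (disk M).X k,
      f 1 = C.d 1 0 ≫ β ≫ e₀.inv ∧ f 0 = β ≫ e₁.inv :=
    ⟨Function.update (Function.update (fun _ => 0) 0 (β ≫ e₁.inv)) 1 (C.d 1 0 ≫ β ≫ e₀.inv),
      by simp, by simp⟩
  let r : C ⟶ disk M :=
    { f := f
      comm' := fun k l hkl => by
        obtain rfl : l + 1 = k := hkl
        rcases eq_or_ne l 0 with rfl | hl0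
        · change f 1 ≫ (disk M).d 1 0 = C.d 1 0 ≫ f 0
          have : (disk M).d 1 0 = e₀.hom ≫ 𝟙 M ≫ e₁.inv :=
            HomologicalComplex.double_d (𝟙 M) hrel h10
          rw [hf1, hf0, this]
          simp
        · rcases eq_or_ne l 1 with rfl | hl1
          · have : (disk M).d (1 + 1) 1 = 0 :=
              HomologicalComplex.double_d_eq_zero₀ (𝟙 M) hrel _ _ (by decide)
            rw [hf1, this, comp_zero, C.d_comp_d_assoc, zero_comp]
          · exact (HomologicalComplex.isZero_double_X (𝟙 M) hrel l hl1 hl0).eq_of_tgt _ _ }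
  refine ⟨⟨HomologicalComplex.mkHomFromDouble hrel h10 α (α ≫ C.d 1 0) (by simp)
    (fun k _ => by simp), r, ?_⟩⟩
  refine HomologicalComplex.to_double_hom_ext ?_ ?_
  · change HomologicalComplex.Hom.f _ _ ≫ f 1 = 𝟙 _
    rw [hf1, HomologicalComplex.mkHomFromDouble_f₀]
    have : (e₀.hom ≫ α) ≫ C.d 1 0 ≫ β ≫ e₀.inv = e₀.hom ≫ (α ≫ C.d 1 0 ≫ β) ≫ e₀.inv := by
      simp
    refine this.trans ?_
    rw [h, Category.id_comp, Iso.hom_inv_id]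
  · change HomologicalComplex.Hom.f _ _ ≫ f 0 = 𝟙 _
    rw [hf0, HomologicalComplex.mkHomFromDouble_f₁]
    have : (e₁.hom ≫ α ≫ C.d 1 0) ≫ β ≫ e₁.inv = e₁.hom ≫ (α ≫ C.d 1 0 ≫ β) ≫ e₁.inv := by
      simp
    refine this.trans ?_
    rw [h, Category.id_comp, Iso.hom_inv_id]

theorem retract_disk_of_isIso {M : Mod} {i j : ℤ} (hij : j + 1 = i) (α : M ⟶ C.X i)
    (β : C.X j ⟶ M) [h : IsIso (α ≫ C.d i j ≫ β)] :
    ∃ s, Nonempty (Retract (shift s (disk M)) C) := by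
  obtain ⟨s, rfl⟩ : ∃ s, j = 0 - s := ⟨-j, by ring⟩
  obtain rfl : i = 1 - s := by omega
  refine ⟨-s, retract_of_shift s (retract_disk (C := shift s C) α
    (β ≫ inv (α ≫ C.d (1 - s) (0 - s) ≫ β)) ?_)⟩
  have := IsIso.hom_inv_id (α ≫ C.d (1 - s) (0 - s) ≫ β)
  rw [Category.assoc, Category.assoc] at this
  exact this

/-- A strand is a retract of `C` if there are elements `x i` and functionals `ψ i` that define maps
between the cells of the strand and the terms of `C`, that are compatible with the differentials, and
that pair to `1`. -/
theorem retract_strand (hC : ∀ i, IsFixedPointFunctor (C.X i)) (c : ℤ → Cell)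
    (hc : ∀ i, ¬ (c (i + 2) = .F ∧ c (i + 1) = .H ∧ c i = .F)) (s : ℤ)
    (x : ∀ i, (C.X i).Θ) (ψ : ∀ i, Module.Dual (ZMod 2) (C.X i).Θ)
    (hx : ∀ i, (c (i - s)).IsElem (x i)) (hψ : ∀ i, (c (i - s)).IsCoord (ψ i))
    (hdx : ∀ i j, j + 1 = i → (C.d i j).mapΘ (x i) = Cell.act (x j) (c (i - s)) (c (j - s)))
    (hdψ : ∀ i j, j + 1 = i → ∀ u,
      ψ j ((C.d i j).mapΘ u) = Cell.coact (ψ i) (c (i - s)) (c (j - s)) u)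
    (hF : ∀ i, c (i - s) = .F → ψ i (norm _ (x i)) = 1) (hH : ∀ i, c (i - s) = .H → ψ i (x i) = 1) :
    Nonempty (Retract (shift s (strand c hc)) C) := by
  choose φ hφ using fun i => Cell.exists_from (hC i) (c (i - s)) (x i) (hx i)
  choose ρ hρ using fun i => Cell.exists_to (c (i - s)) (ψ i) (hψ i)
  have hd : ∀ i j, j + 1 = i →
      (shift s (strand c hc)).d i j = (c (i - s)).map (c (j - s)) := fun i j hij =>
    if_pos (show j - s + 1 = i - s by rw [← hij]; ring)
  let I : shift s (strand c hc) ⟶ C :=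
    { f := φ
      comm' := fun i j hij => by
        rw [hd i j hij]
        refine Cell.from_ext (hC j) ?_
        rw [Cell.map_comp_gen _ _ _ _ (hφ j), ← hdx i j hij, ← hφ i]
        rfl }
  let r : C ⟶ shift s (strand c hc) :=
    { f := ρ
      comm' := fun i j hij => by
        rw [hd i j hij]
        refine Cell.to_ext fun u => ?_
        rw [Cell.comp_map_coord _ _ _ _ (hρ i), ← hdψ i j hij, ← hρ j]
        rfl }
  have : ∀ n, IsIso ((I ≫ r).f n) := fun n =>
    Cell.isIso_of_coord (c (n - s)) (φ n) (ρ n) (x n) (ψ n) (hφ n) (hρ n) (hF n) (hH n)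
  have := HomologicalComplex.Hom.isIso_of_components (I ≫ r)
  exact ⟨⟨I, r ≫ inv (I ≫ r), by rw [← Category.assoc, IsIso.hom_inv_id]⟩⟩

/-- A family that is prescribed on an interval and at the two adjacent indices, and is zero
elsewhere. -/
theorem exists_extension_by_zero {V : ℤ → Type*} [∀ i, Zero (V i)] {e a : ℤ} (h : e ≤ a)
    (x : ∀ i, V i) (y : V (a + 1)) (z : V (e - 1)) :
    ∃ f : ∀ i, V i, f (a + 1) = y ∧ f (e - 1) = z ∧ (∀ i, e ≤ i → i ≤ a → f i = x i) ∧
      ∀ i, (a + 1 < i ∨ i < e - 1) → f i = 0 := by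
  refine ⟨Function.update (Function.update (fun i => if e ≤ i ∧ i ≤ a then x i else 0) (a + 1) y)
    (e - 1) z, ?_, by simp, fun i h1 h2 => ?_, fun i hi => ?_⟩
  · rw [Function.update_of_ne (by omega), Function.update_self]
  · rw [Function.update_of_ne (by omega), Function.update_of_ne (by omega), if_pos ⟨h1, h2⟩]
  · rw [Function.update_of_ne (by omega), Function.update_of_ne (by omega), if_neg (by omega)]

theorem Cell.act_zero_left {M : Mod} (x : M.Θ) (b : Cell) : Cell.act x .zero b = 0 := by
  cases b <;> rfl

theorem Cell.act_zero_right {M : Mod} (x : M.Θ) (b : Cell) : Cell.act x b .zero = 0 := by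
  cases b <;> rfl

theorem Cell.coact_zero_left {M : Mod} (ψ : Module.Dual (ZMod 2) M.Θ) (b : Cell) :
    Cell.coact ψ .zero b = 0 := by
  cases b <;> rfl

theorem Cell.coact_zero_right {M : Mod} (ψ : Module.Dual (ZMod 2) M.Θ) (b : Cell) :
    Cell.coact ψ b .zero = 0 := by
  cases b <;> rfl

/-- A chain in the degrees from `e` to `a`, with a dual chain, splits off a strand with copies of `F`
in these degrees. The cells `cT` and `cB` in the two adjacent degrees are `H` or zero. -/
theorem retract_strand_of_chain (hC : ∀ i, IsFixedPointFunctor (C.X i)) {e a : ℤ} (hea : e ≤ a)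
    (x : ∀ i, (C.X i).Θ) (ψ : ∀ i, Module.Dual (ZMod 2) (C.X i).Θ)
    (h1 : ∀ i, e ≤ i → i ≤ a → ψ i (norm _ (x i)) = 1)
    (hdx : ∀ i, e < i → i ≤ a → (C.d i (i - 1)).mapΘ (x i) = norm _ (x (i - 1)) ∧
      ∀ u, ψ (i - 1) ((C.d i (i - 1)).mapΘ u) = ψ i (norm _ u))
    (cT cB : Cell) (hcT : cT ≠ .F) (hcB : cB ≠ .F)
    (y : (C.X (a + 1)).Θ) (η : Module.Dual (ZMod 2) (C.X (a + 1)).Θ)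
    (hy : cT.IsElem y) (hη : cT.IsCoord η) (hηy : cT = .H → η y = 1)
    (hdy : (C.d (a + 1) a).mapΘ y = Cell.act (x a) cT .F)
    (hdη : ∀ u, ψ a ((C.d (a + 1) a).mapΘ u) = Cell.coact η cT .F u)
    (hddη : ∀ u, η ((C.d (a + 1 + 1) (a + 1)).mapΘ u) = 0)
    (z : (C.X (e - 1)).Θ) (χ : Module.Dual (ZMod 2) (C.X (e - 1)).Θ)
    (hz : cB.IsElem z) (hχ : cB.IsCoord χ) (hχz : cB = .H → χ z = 1)
    (hdz : (C.d e (e - 1)).mapΘ (x e) = Cell.act z .F cB)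
    (hdχ : ∀ u, χ ((C.d e (e - 1)).mapΘ u) = Cell.coact (ψ e) .F cB u)
    (hddz : (C.d (e - 1) (e - 1 - 1)).mapΘ z = 0)
    (c : ℤ → Cell) (hc : ∀ i, ¬ (c (i + 2) = .F ∧ c (i + 1) = .H ∧ c i = .F)) (s : ℤ)
    (hT : c (a + 1 - s) = cT) (hB : c (e - 1 - s) = cB)
    (hM : ∀ i, e ≤ i → i ≤ a → c (i - s) = .F)
    (h0 : ∀ i, (a + 1 < i ∨ i < e - 1) → c (i - s) = .zero) :
    Nonempty (Retract (shift s (strand c hc)) C) := by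
  obtain ⟨x', xT, xB, xM, x0⟩ := exists_extension_by_zero hea x y z
  obtain ⟨ψ', ψT, ψB, ψM, ψ0⟩ := exists_extension_by_zero hea ψ η χ
  have pos : ∀ i, (a + 1 < i ∨ i < e - 1) ∨ i = a + 1 ∨ (e ≤ i ∧ i ≤ a) ∨ i = e - 1 := by omega
  refine retract_strand hC c hc s x' ψ' ?_ ?_ ?_ ?_ ?_ ?_
  · intro i
    rcases pos i with h | rfl | ⟨h, h'⟩ | rfl
    · rw [h0 i h]; exact x0 i h
    · rwa [hT, xT]
    · rw [hM i h h']; trivial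
    · rwa [hB, xB]
  · intro i
    rcases pos i with h | rfl | ⟨h, h'⟩ | rfl
    · rw [h0 i h]; exact ψ0 i h
    · rwa [hT, ψT]
    · rw [hM i h h']; trivial
    · rwa [hB, ψB]
  · intro i j hij
    rcases pos i with h | rfl | ⟨h, h'⟩ | rfl
    · rw [h0 i h, x0 i h, map_zero, Cell.act_zero_left]
    · obtain rfl : j = a := by omega
      rw [xT, hT, xM j hea le_rfl, hM j hea le_rfl, hdy]
    · obtain rfl : j = i - 1 := by omega
      rcases h.eq_or_lt with rfl | h''
      · rw [xM _ h h', hM _ h h', hB, xB, hdz]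
      · rw [xM _ h h', hM _ h h', xM _ (by omega) (by omega), hM _ (by omega) (by omega),
          (hdx i h'' h').1]
        rfl
    · obtain rfl : j = e - 1 - 1 := by omega
      rw [xB, hddz, h0 (e - 1 - 1) (by omega), Cell.act_zero_right]
  · intro i j hij u
    rcases pos j with h | rfl | ⟨h, h'⟩ | rfl
    · rw [h0 j h, ψ0 j h, Cell.coact_zero_right]; rfl
    · obtain rfl : i = a + 1 + 1 := by omega
      rw [ψT, hddη, h0 (a + 1 + 1) (by omega), Cell.coact_zero_left]; rfl
    · rcases h'.eq_or_lt with rfl | h''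
      · obtain rfl : i = j + 1 := by omega
        rw [ψM _ h h', hM _ h h', hT, ψT, hdη]
      · obtain rfl : j = i - 1 := by omega
        rw [ψM _ h h', hM _ h h', ψM i (by omega) (by omega), hM i (by omega) (by omega),
          (hdx i (by omega) (by omega)).2]
        rfl
    · obtain rfl : i = e := by omega
      rw [ψB, hB, ψM i le_rfl hea, hM i le_rfl hea, hdχ]
  · intro i hi
    rcases pos i with h | rfl | ⟨h, h'⟩ | rfl
    · simp [h0 i h] at hi
    · exact absurd (hT.symm.trans hi) hcT
    · rw [ψM i h h', xM i h h', h1 i h h']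
    · exact absurd (hB.symm.trans hi) hcB
  · intro i hi
    rcases pos i with h | rfl | ⟨h, h'⟩ | rfl
    · simp [h0 i h] at hi
    · rw [ψT, xT]; exact hηy (hT.symm.trans hi)
    · simp [hM i h h'] at hi
    · rw [ψB, xB]; exact hχz (hB.symm.trans hi)

end Retracts

/-! ### A nonzero complex has a summand of one of the given types -/

section Existence

variable {C : ChainComplex Mod ℤ}

theorem retract_disk_cell (hC : ∀ i, IsFixedPointFunctor (C.X i)) (c : Cell) {i j : ℤ}
    (hij : j + 1 = i) (u : (C.X i).Θ) (ψ : Module.Dual (ZMod 2) (C.X j).Θ) (hu : c.IsElem u)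
    (hψ : c.IsCoord ψ) (hF : c = .F → ψ (norm _ ((C.d i j).mapΘ u)) = 1)
    (hH : c = .H → ψ ((C.d i j).mapΘ u) = 1) :
    ∃ s, Nonempty (Retract (shift s (disk c.obj)) C) := by
  obtain ⟨α, hα⟩ := Cell.exists_from (hC i) c u hu
  obtain ⟨β, hβ⟩ := Cell.exists_to c ψ hψ
  have := Cell.isIso_of_coord c (α ≫ C.d i j) β _ ψ (by rw [← hα]; rfl) hβ hF hH
  rw [Category.assoc] at this
  exact retract_disk_of_isIso hij α β

/-- Over `ℤ/2`, a vector outside a subspace is separated from it by a functional with value `1`. -/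
theorem exists_dual_eq_one {U : Type*} [AddCommGroup U] [Module (ZMod 2) U]
    (P : Submodule (ZMod 2) U) {u : U} (hu : u ∉ P) :
    ∃ ψ : Module.Dual (ZMod 2) U, ψ u = 1 ∧ ∀ v ∈ P, ψ v = 0 := by
  obtain ⟨ψ, h, hP⟩ := P.exists_le_ker_of_notMem hu
  have h2 : ∀ y : ZMod 2, y ≠ 0 → y = 1 := by decide
  exact ⟨ψ, h2 _ h, fun v hv => hP hv⟩

theorem d_d_apply (i j k : ℤ) (u : (C.X i).Θ) : (C.d j k).mapΘ ((C.d i j).mapΘ u) = 0 :=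
  LinearMap.congr_fun (congrArg MackeyModule.Hom.mapΘ (C.d_comp_d i j k)) u

/-- If `1 + t` vanishes on a nonzero complex, and so do the differentials, then a copy of `H`
splits off. -/
theorem retract_H_of_norm_eq_zero (hC : ∀ i, IsFixedPointFunctor (C.X i))
    (hn : ∀ i (u : (C.X i).Θ), norm _ u = 0)
    (hd : ∀ i j, j + 1 = i → ∀ u : (C.X i).Θ, (C.d i j).mapΘ u = 0) {i : ℤ} {v : (C.X i).Θ}
    (hv : v ≠ 0) : Nonempty (Retract (shift i (HH 0)) C) := by
  obtain ⟨ψ, hψ, -⟩ := exists_dual_eq_one ⊥ (u := v) (by simpa using hv)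
  have hc : ∀ k, (if k - i = -0 then Cell.H
      else if (0 ≤ k - i ∧ k - i < -0) ∨ (-0 < k - i ∧ k - i ≤ 0) then .F else .zero) =
      if k = i then Cell.H else .zero := fun k => by
    split_ifs <;> first | rfl | (exfalso; omega)
  refine retract_strand hC _ (by grind) i (Function.update (fun _ => 0) i v)
    (Function.update (fun _ => 0) i ψ) ?_ ?_ ?_ ?_ ?_ ?_
  · intro k
    rw [hc]
    rcases eq_or_ne k i with rfl | hk
    · rw [if_pos rfl]; exact hn _ _
    · rw [if_neg hk]; exact Function.update_of_ne hk _ _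
  · intro k
    rw [hc]
    rcases eq_or_ne k i with rfl | hk
    · rw [if_pos rfl]; exact fun u => by rw [hn, map_zero]
    · rw [if_neg hk]; exact Function.update_of_ne hk _ _
  · intro k l hkl
    rw [hc, hc, hd k l hkl]
    split_ifs <;> rfl
  · intro k l hkl u
    rw [hc, hc, hd k l hkl, map_zero]
    split_ifs <;> rfl
  · intro k hk
    rw [hc] at hk
    split_ifs at hk
  · intro k hk
    rw [hc] at hk
    split_ifs at hk with h
    subst h
    simpa using hψ

/-- In a complex whose differentials are in the radical and on which `1 + t` does not vanish, a
maximal chain that starts in the highest possible degree splits off. It starts in the image of a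
copy of `H` if there is one. -/
theorem exists_retract_of_norm_ne_zero (hC : ∀ i, IsFixedPointFunctor (C.X i)) {lo hi : ℤ}
    (hb : ∀ i, (i < lo ∨ hi < i) → Subsingleton (C.X i).Θ)
    (hnd : ∀ i j, j + 1 = i → ∀ u : (C.X i).Θ, norm _ ((C.d i j).mapΘ u) = 0)
    (hdn : ∀ i j, j + 1 = i → ∀ u : (C.X i).Θ, norm _ u = 0 →
      (C.d i j).mapΘ u ∈ LinearMap.range (norm (C.X j)))
    (hn : ∃ i, ∃ u : (C.X i).Θ, norm _ u ≠ 0) :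
    ∃ (S : Summand) (s : ℤ), Nonempty (Retract (shift s S.complex) C) := by
  obtain ⟨a, ⟨u₀, hu₀⟩, ha⟩ := Int.exists_greatest_of_bdd
    (P := fun i => ∃ u : (C.X i).Θ, norm _ u ≠ 0) ⟨hi, fun i ⟨u, hu⟩ => by
      by_contra h
      have := hb i (Or.inr (not_le.1 h))
      exact hu (Subsingleton.elim _ _)⟩ hn
  have htop : ∀ u : (C.X (a + 1)).Θ, norm _ u = 0 := fun u => by
    by_contra h
    have := ha _ ⟨u, h⟩
    omega
  let dl : ∀ i j, (C.X i).Θ →ₗ[ZMod 2] (C.X j).Θ := fun i j => (C.d i j).mapΘ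
  have hlo : ∀ i < lo, Subsingleton (C.X i).Θ := fun i h => hb i (Or.inl h)
  obtain ⟨e, x, ψ, hea, h1, hc, hbot, cT, hcT, y, η, hy, hη, hηy, hdy, hdη, hddη⟩ :
      ∃ (e : ℤ) (x : ∀ i, (C.X i).Θ) (ψ : ∀ i, Module.Dual (ZMod 2) (C.X i).Θ), e ≤ a ∧
      (∀ i, e ≤ i → i ≤ a → ψ i (norm _ (x i)) = 1) ∧
      (∀ i, e < i → i ≤ a → dl i (i - 1) (x i) = norm _ (x (i - 1)) ∧
        ∀ u, ψ (i - 1) (dl i (i - 1) u) = ψ i (norm _ u)) ∧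
      (dl e (e - 1) (x e) = 0 ∨ ∃ χ : Module.Dual (ZMod 2) (C.X (e - 1)).Θ,
        (∀ v, χ (norm _ v) = 0) ∧ ∀ u, χ (dl e (e - 1) u) = ψ e (norm _ u)) ∧
      ∃ cT : Cell, (cT = .H ∨ cT = .zero) ∧ ∃ (y : (C.X (a + 1)).Θ)
        (η : Module.Dual (ZMod 2) (C.X (a + 1)).Θ), cT.IsElem y ∧ cT.IsCoord η ∧
        (cT = .H → η y = 1) ∧ (C.d (a + 1) a).mapΘ y = Cell.act (x a) cT .F ∧
        (∀ u, ψ a ((C.d (a + 1) a).mapΘ u) = Cell.coact η cT .F u) ∧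
        ∀ u, η ((C.d (a + 1 + 1) (a + 1)).mapΘ u) = 0 := by
    by_cases hW : LinearMap.range (dl (a + 1) a) = ⊥
    · have hd : ∀ u, (C.d (a + 1) a).mapΘ u = 0 := fun u =>
        LinearMap.congr_fun (LinearMap.range_eq_bot.1 hW) u
      obtain ⟨e, x, ψ, hea, -, h1, hc, hbot⟩ := exists_maximal_chain (f := fun i => norm (C.X i))
        (d := dl) lo a hlo (LinearMap.range (norm (C.X a)))
        (fun h => hu₀ (LinearMap.congr_fun (LinearMap.range_eq_bot.1 h) u₀)) le_rfl
      exact ⟨e, x, ψ, hea, h1, hc, hbot, .zero, Or.inr rfl, 0, 0, rfl, rfl, by simp,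
        map_zero _, fun u => by rw [hd, map_zero]; rfl, fun u => rfl⟩
    · obtain ⟨e, x, ψ, hea, ⟨y, hy⟩, h1, hc, hbot⟩ :=
        exists_maximal_chain (f := fun i => norm (C.X i)) (d := dl) lo a hlo _ hW (by
          rintro _ ⟨u, rfl⟩
          exact hdn _ _ rfl u (htop u))
      exact ⟨e, x, ψ, hea, h1, hc, hbot, .H, Or.inl rfl, y, (ψ a).comp (dl (a + 1) a), htop y,
        fun v => by rw [htop, map_zero], fun _ => (congrArg (ψ a) hy).trans (h1 a hea le_rfl),
        hy, fun u => rfl, fun u => (congrArg (ψ a) (d_d_apply _ _ _ u)).trans (map_zero _)⟩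
  obtain ⟨cB, hcB, z, χ, hz, hχ, hχz, hdz, hdχ, hddz⟩ : ∃ cB : Cell, (cB = .H ∨ cB = .zero) ∧
      ∃ (z : (C.X (e - 1)).Θ) (χ : Module.Dual (ZMod 2) (C.X (e - 1)).Θ), cB.IsElem z ∧
      cB.IsCoord χ ∧ (cB = .H → χ z = 1) ∧ (C.d e (e - 1)).mapΘ (x e) = Cell.act z .F cB ∧
      (∀ u, χ ((C.d e (e - 1)).mapΘ u) = Cell.coact (ψ e) .F cB u) ∧
      (C.d (e - 1) (e - 1 - 1)).mapΘ z = 0 := by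
    rcases hbot with h | ⟨χ, hχ, hχd⟩
    · exact ⟨.zero, Or.inr rfl, 0, 0, rfl, rfl, by simp, h, fun u => rfl, map_zero _⟩
    · exact ⟨.H, Or.inl rfl, dl e (e - 1) (x e), χ, hnd _ _ (by omega) _, hχ,
        fun _ => (hχd _).trans (h1 e le_rfl hea), rfl, hχd, d_d_apply _ _ _ _⟩
  have hcT' : cT ≠ .F := by rcases hcT with rfl | rfl <;> simp
  have hcB' : cB ≠ .F := by rcases hcB with rfl | rfl <;> simp
  have key := retract_strand_of_chain hC hea x ψ h1 hc cT cB hcT' hcB' y η hy hη hηy hdy hdη hddη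
    z χ hz hχ hχz hdz hdχ hddz
  rcases hcT with rfl | rfl <;> rcases hcB with rfl | rfl
  · refine ⟨.B (a - e).toNat, a + 1, key _ (by clear * -; grind) (a + 1) ?_ ?_ ?_ ?_⟩
    all_goals intros; split_ifs <;> first | rfl | (exfalso; omega)
  · refine ⟨.H (e - a - 1), e, key _ (by clear * -; grind) e ?_ ?_ ?_ ?_⟩
    all_goals intros; split_ifs <;> first | rfl | (exfalso; omega)
  · refine ⟨.H (a - e + 1), a, key _ (by clear * -; grind) a ?_ ?_ ?_ ?_⟩
    all_goals intros; split_ifs <;> first | rfl | (exfalso; omega)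
  · refine ⟨.A (a - e).toNat, e, key _ (by clear * -; grind) e ?_ ?_ ?_ ?_⟩
    all_goals intros; split_ifs <;> first | rfl | (exfalso; omega)

theorem exists_retract (hC : ∀ i, IsFixedPointFunctor (C.X i)) {lo hi : ℤ}
    (hb : ∀ i, (i < lo ∨ hi < i) → Subsingleton (C.X i).Θ) (h : ∃ i, ∃ v : (C.X i).Θ, v ≠ 0) :
    ∃ (S : Summand) (s : ℤ), Nonempty (Retract (shift s S.complex) C) := by
  by_cases hnd : ∀ i j, j + 1 = i → ∀ u : (C.X i).Θ, norm _ ((C.d i j).mapΘ u) = 0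
  · by_cases hdn : ∀ i j, j + 1 = i → ∀ u : (C.X i).Θ, norm _ u = 0 →
        (C.d i j).mapΘ u ∈ LinearMap.range (norm (C.X j))
    · by_cases hn : ∃ i, ∃ u : (C.X i).Θ, norm _ u ≠ 0
      · exact exists_retract_of_norm_ne_zero hC hb hnd hdn hn
      · push Not at hn
        obtain ⟨i, v, hv⟩ := h
        refine ⟨.H 0, i, retract_H_of_norm_eq_zero hC hn (fun i j hij u => ?_) hv⟩
        obtain ⟨w, hw⟩ := hdn i j hij u (hn _ _)
        rw [← hw, hn]
    · push Not at hdn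
      obtain ⟨i, j, hij, u, hu, hdu⟩ := hdn
      obtain ⟨ψ, h1, hψ⟩ := exists_dual_eq_one _ hdu
      obtain ⟨s, hs⟩ := retract_disk_cell hC .H hij u ψ hu (fun v => hψ _ ⟨v, rfl⟩) (by simp)
        (fun _ => h1)
      exact ⟨.diskH, s, hs⟩
  · push Not at hnd
    obtain ⟨i, j, hij, u, hu⟩ := hnd
    obtain ⟨ψ, h1, -⟩ := exists_dual_eq_one ⊥ (by simpa using hu)
    obtain ⟨s, hs⟩ := retract_disk_cell hC .F hij u ψ trivial trivial (fun _ => h1) (by simp)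
    exact ⟨.diskF, s, hs⟩

end Existence

/-! ### Decomposition by repeated splitting -/

section Decomposition

/-- If `X 0` is a direct summand of `Y` and the complement is the direct sum of the other `X j`, then
`Y` is the direct sum of all `X j`. -/
theorem nonempty_iso_biproduct_of_splitting {𝒜 : Type*} [Category 𝒜] [Preadditive 𝒜]
    [HasFiniteBiproducts 𝒜] {N : ℕ} (X : Fin (N + 1) → 𝒜) {Y Y' : 𝒜} (i : X 0 ⟶ Y) (r : Y ⟶ X 0)
    (i' : Y' ⟶ Y) (r' : Y ⟶ Y') (hir : i ≫ r = 𝟙 _) (hir' : i' ≫ r' = 𝟙 _) (h₁ : i ≫ r' = 0)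
    (h₂ : i' ≫ r = 0) (h : r ≫ i + r' ≫ i' = 𝟙 _) (e : Y' ≅ ⨁ fun j : Fin N => X j.succ) :
    Nonempty (Y ≅ ⨁ X) := by
  let b : Bicone X :=
    { pt := Y
      π := Fin.cases r fun j => r' ≫ e.hom ≫ biproduct.π (fun j : Fin N => X j.succ) j
      ι := Fin.cases i fun j => biproduct.ι (fun j : Fin N => X j.succ) j ≫ e.inv ≫ i'
      ι_π := fun j k => by
        cases j using Fin.cases with
        | zero =>
          cases k using Fin.cases with
          | zero => simpa using hir
          | succ k =>
            rw [dif_neg (Fin.succ_ne_zero k).symm]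
            simp only [Fin.cases_zero, Fin.cases_succ]
            rw [← Category.assoc, h₁, zero_comp]
        | succ j =>
          cases k using Fin.cases with
          | zero =>
            rw [dif_neg (Fin.succ_ne_zero j)]
            simp [h₂]
          | succ k =>
            simp only [Fin.cases_succ, Category.assoc]
            rw [← Category.assoc i', hir', Category.id_comp, Iso.inv_hom_id_assoc, biproduct.ι_π]
            simp only [Fin.succ_inj] }
  have htot : ∑ j, b.π j ≫ b.ι j = 𝟙 b.pt := by
    rw [Fin.sum_univ_succ]
    simp only [b, Fin.cases_zero, Fin.cases_succ]
    rw [← h]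
    congr 1
    have : ∀ j : Fin N, (r' ≫ e.hom ≫ biproduct.π (fun j : Fin N => X j.succ) j) ≫
        biproduct.ι (fun j : Fin N => X j.succ) j ≫ e.inv ≫ i' =
        (r' ≫ e.hom) ≫ (biproduct.π (fun j : Fin N => X j.succ) j ≫
          biproduct.ι (fun j : Fin N => X j.succ) j) ≫ e.inv ≫ i' := fun j => by
      simp only [Category.assoc]
    rw [Finset.sum_congr rfl fun j _ => this j, ← Preadditive.comp_sum, ← Preadditive.sum_comp,
      biproduct.total]
    simp
  exact ⟨biproduct.uniqueUpToIso X (isBilimitOfTotal b htot)⟩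

theorem Summand.exists_nontrivial (S : Summand) : ∃ k, Nontrivial (S.complex.X k).Θ := by
  have hF : Nontrivial C2.F.Θ := inferInstanceAs (Nontrivial (ZMod 2 × ZMod 2))
  have hH : Nontrivial C2.H.Θ := inferInstanceAs (Nontrivial (ZMod 2))
  have hcell : ∀ (c : ℤ → Cell) hc (k : ℤ), c k = .F ∨ c k = .H →
      Nontrivial ((strand c hc).X k).Θ := by
    intro c hc k h
    change Nontrivial (c k).obj.Θ
    rcases h with h | h
    · rw [h]; exact hF
    · rw [h]; exact hH
  have hdisk : ∀ M : Mod, Nontrivial M.Θ → Nontrivial ((disk M).X 1).Θ := by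
    intro M hM
    let e : (disk M).X 1 ≅ M :=
      HomologicalComplex.doubleXIso₀ (𝟙 M) (show (ComplexShape.down ℤ).Rel 1 0 from rfl)
    refine Function.Injective.nontrivial (f := e.inv.mapΘ)
      (Function.LeftInverse.injective (g := e.hom.mapΘ) fun x => ?_)
    exact LinearMap.congr_fun (congrArg MackeyModule.Hom.mapΘ e.inv_hom_id) x
  cases S with
  | A k => exact ⟨0, hcell _ (by grind) 0 (Or.inl (if_pos (by omega)))⟩
  | B r => exact ⟨0, hcell _ (by grind) 0 (Or.inr (if_pos (by omega)))⟩
  | H n => exact ⟨-n, hcell _ (by grind) (-n) (Or.inr (if_pos rfl))⟩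
  | diskF => exact ⟨1, hdisk _ hF⟩
  | diskH => exact ⟨1, hdisk _ hH⟩

instance : HasEqualizers Mod := Preadditive.hasEqualizers_of_hasKernels

/-- The total dimension of the values at the free orbit decreases when a summand is split off, so
that finitely many steps exhaust the complex. -/
theorem exists_decomposition (lo hi : ℤ) (n : ℕ) (C : ChainComplex Mod ℤ)
    (hC : ∀ i, IsFixedPointFunctor (C.X i))
    (hb : ∀ i, (i < lo ∨ hi < i) → Subsingleton (C.X i).Θ)
    (hn : ∑ i ∈ Finset.Icc lo hi, Module.finrank (ZMod 2) (C.X i).Θ = n) :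
    ∃ (N : ℕ) (S : Fin N → Summand) (s : Fin N → ℤ),
      Nonempty (C ≅ ⨁ fun j => shift (s j) (S j).complex) := by
  induction n using Nat.strong_induction_on generalizing C with
  | _ n ih =>
  by_cases h : ∃ i, ∃ v : (C.X i).Θ, v ≠ 0
  · obtain ⟨S₀, s₀, ⟨i, r, hir⟩⟩ := exists_retract hC hb h
    let ι := kernel.ι r
    let q := kernel.lift r (𝟙 C - r ≫ i) (by simp [hir])
    have hq : q ≫ ι = 𝟙 C - r ≫ i := kernel.lift_ι _ _ _
    have hsum : r ≫ i + q ≫ ι = 𝟙 C := by rw [hq, add_sub_cancel]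
    have hιq : ι ≫ q = 𝟙 _ := by
      rw [← cancel_mono ι, Category.assoc, hq, Preadditive.comp_sub, ← Category.assoc ι r,
        kernel.condition]
      simp
    have hiq : i ≫ q = 0 := by
      rw [← cancel_mono ι, Category.assoc, hq, Preadditive.comp_sub, ← Category.assoc i r, hir]
      simp
    have hιq' : ∀ k, ι.f k ≫ q.f k = 𝟙 _ := fun k => HomologicalComplex.congr_hom hιq k
    have hinj : ∀ k, Function.Injective (ι.f k).mapΘ := fun k =>
      Function.LeftInverse.injective (g := (q.f k).mapΘ)
        fun x => LinearMap.congr_fun (congrArg MackeyModule.Hom.mapΘ (hιq' k)) x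
    have hle : ∀ k, Module.finrank (ZMod 2) ((kernel r).X k).Θ ≤
        Module.finrank (ZMod 2) (C.X k).Θ := fun k => by
      have := (hC k).finite
      exact LinearMap.finrank_le_finrank_of_injective
        (f := ((ι.f k).mapΘ : ((kernel r).X k).Θ →ₗ[ZMod 2] (C.X k).Θ)) (hinj k)
    have hb' : ∀ k, (k < lo ∨ hi < k) → Subsingleton ((kernel r).X k).Θ := fun k hk => by
      have := hb k hk
      exact (hinj k).subsingleton
    -- In a degree in which the summand is nonzero, the kernel is a proper submodule.
    obtain ⟨k, hk⟩ : ∃ k, Module.finrank (ZMod 2) ((kernel r).X k).Θ <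
        Module.finrank (ZMod 2) (C.X k).Θ := by
      obtain ⟨l, hl⟩ := S₀.exists_nontrivial
      obtain ⟨k, rfl⟩ : ∃ k, l = k - s₀ := ⟨l + s₀, by ring⟩
      obtain ⟨v, hv⟩ := exists_ne (0 : (S₀.complex.X (k - s₀)).Θ)
      refine ⟨k, lt_of_le_of_ne (hle k) fun heq => hv ?_⟩
      have := (hC k).finite
      have : Module.Finite (ZMod 2) ((kernel r).X k).Θ := Module.Finite.of_injective
        ((ι.f k).mapΘ : ((kernel r).X k).Θ →ₗ[ZMod 2] (C.X k).Θ) (hinj k)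
      obtain ⟨w, hw⟩ := (LinearMap.injective_iff_surjective_of_finrank_eq_finrank
        (f := ((ι.f k).mapΘ : ((kernel r).X k).Θ →ₗ[ZMod 2] (C.X k).Θ)) heq).1 (hinj k)
        ((i.f k).mapΘ v)
      have h1 : (r.f k).mapΘ ((i.f k).mapΘ v) = v :=
        LinearMap.congr_fun (congrArg MackeyModule.Hom.mapΘ (HomologicalComplex.congr_hom hir k)) v
      have h2 : (r.f k).mapΘ ((ι.f k).mapΘ w) = 0 :=
        LinearMap.congr_fun (congrArg MackeyModule.Hom.mapΘ
          (HomologicalComplex.congr_hom (kernel.condition r) k)) w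
      rw [← h1, ← hw]
      exact h2
    have hkmem : k ∈ Finset.Icc lo hi := by
      by_contra hk'
      have := hb k (by simp only [Finset.mem_Icc] at hk'; omega)
      have h0 : Module.finrank (ZMod 2) (C.X k).Θ = 0 := Module.finrank_zero_of_subsingleton
      omega
    obtain ⟨N, S, s, ⟨e⟩⟩ := ih _ (hn ▸ Finset.sum_lt_sum (fun k _ => hle k) ⟨k, hkmem, hk⟩)
      (kernel r) (fun k => (hC k).of_retract (ι.f k) (q.f k) (hιq' k)) hb' rfl
    exact ⟨N + 1, Fin.cons S₀ S, Fin.cons s₀ s, nonempty_iso_biproduct_of_splitting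
      (fun j => shift ((Fin.cons s₀ s : Fin (N + 1) → ℤ) j)
        ((Fin.cons S₀ S : Fin (N + 1) → Summand) j).complex) i r ι q hir hιq hiq
      (kernel.condition r) hsum e⟩
  · push Not at h
    have hz : IsZero C := by
      rw [IsZero.iff_id_eq_zero]
      ext1 k
      exact (hC k).hom_ext fun x => by rw [h k x, map_zero, map_zero]
    refine ⟨0, Fin.elim0, Fin.elim0, ⟨hz.iso ?_⟩⟩
    rw [IsZero.iff_id_eq_zero]
    exact biproduct.hom_ext _ _ fun j => j.elim0

end Decomposition

end C2

theorem theorem4p5 (C : ChainComplex C2.Mod ℤ) (hb : C2.IsBounded C)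
    (hC : ∀ i, C2.IsFiniteFree (C.X i)) :
    ∃ (N : ℕ) (S : Fin N → C2.Summand) (s : Fin N → ℤ),
      Nonempty (C ≅ ⨁ fun j => C2.shift (s j) (S j).complex) := by
  obtain ⟨lo, hi, hz⟩ := hb
  refine C2.exists_decomposition lo hi _ C (fun i => (hC i).isFixedPointFunctor) (fun i h => ?_) rfl
  have := (IsZero.iff_id_eq_zero _).1 (hz i h)
  have key : ∀ v : (C.X i).Θ, v = 0 := fun v =>
    LinearMap.congr_fun (congrArg MackeyModule.Hom.mapΘ this) v
  exact ⟨fun v w => (key v).trans (key w).symm⟩
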